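/- Let $(T_t)_{t\ge 0}$ be a strongly continuous semigroup of bounded linear operators on a complex Banach space $X$, with generator $B$, and assume that the resolvent set $\rho(B)$ contains $(0,\infty)$. For $\lambda>0$ let $$\tilde A_\lambda=\lambda(\lambda I-B)^{-1}\in\mathcal L(X)$$ be the Abel average. It is given by $\tilde A_\lambda x=\lambda\int_0^\infty e^{-\lambda s}T_s x\,ds$ for all $\lambda>0$ and $x\in X$ for which this improper Riemann integral converges in norm; for all sufficiently large $\lambda$ it converges for every $x\in X$. The following statements are equivalent: (i) $\rho(B)$ contains the open right half-plane $\{\zeta\in\mathbb C:\operatorname{Re}\zeta>0\}$ and $X=\operatorname{Ker}B\oplus\operatorname{Im}B$; (ii) for some $\lambda>0$ the sequence $(\tilde A_\lambda^n)_{n\in\mathbb N}$ converges in the operator norm, and $\rho(B)$ contains the open right half-plane; (iii) for every $\lambda>0$ the sequence $(\tilde A_\lambda^n)_{n\in\mathbb N}$ converges in the operator norm. Moreover, whenever $\lambda>0$ and $(\tilde A_\lambda^n)_{n\in\mathbb N}$ converges in the operator norm, its limit is the projection of $X$ onto $\operatorname{Ker}B$ along $\operatorname{Im}B$. Here $\operatorname{Im}B$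 is the image under $B$ of its domain. -/

import Mathlib

open Filter Topology
open scoped NNReal

namespace AbelPower

/-- A strongly continuous (`C₀`-) semigroup of bounded linear operators on `X`. -/
structure C0Semigroup (X : Type*) [NormedAddCommGroup X] [NormedSpace ℂ X] where
  /-- the operators `T_t`, `t ≥ 0` -/
  op : ℝ≥0 → X →L[ℂ] X
  op_zero : op 0 = ContinuousLinearMap.id ℂ X
  op_add : ∀ s t : ℝ≥0, op (s + t) = (op s).comp (op t)
  continuous_orbit : ∀ x : X, Continuous fun t : ℝ≥0 => op t x

section Unbounded

variable {X : Type*} [NormedAddCommGroup X] [NormedSpace ℂ X]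

/-- The kernel of an operator `B` with domain in `X`, as a subspace of `X`. -/
def kernel (B : X →ₗ.[ℂ] X) : Submodule ℂ X :=
  (LinearMap.ker B.toFun).map B.domain.subtype

/-- The image `B(D(B))`. -/
def image (B : X →ₗ.[ℂ] X) : Submodule ℂ X :=
  LinearMap.range B.toFun

/-- `R` is a bounded two-sided inverse of `ζ - B : D(B) → X`. -/
def IsResolventAt (B : X →ₗ.[ℂ] X) (ζ : ℂ) (R : X →L[ℂ] X) : Prop :=
  (∀ x : X, ∃ h : R x ∈ B.domain, ζ • R x - B ⟨R x, h⟩ = x) ∧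
    ∀ x : B.domain, R (ζ • (x : X) - B x) = x

/-- The resolvent set `ρ(B)`. -/
def resolventSet (B : X →ₗ.[ℂ] X) : Set ℂ :=
  {ζ | ∃ R : X →L[ℂ] X, IsResolventAt B ζ R}

open Classical in
/-- The resolvent `R(ζ, B) = (ζ - B)⁻¹` for `ζ ∈ ρ(B)` (and `0` for other `ζ`). -/
noncomputable def resolvent (B : X →ₗ.[ℂ] X) (ζ : ℂ) : X →L[ℂ] X :=
  if h : ∃ R : X →L[ℂ] X, IsResolventAt B ζ R then h.choose else 0

theorem isResolventAt_resolvent {B : X →ₗ.[ℂ] X} {ζ : ℂ} (h : ζ ∈ resolventSet B) :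
    IsResolventAt B ζ (resolvent B ζ) := by
  have h' : ∃ R : X →L[ℂ] X, IsResolventAt B ζ R := h
  rw [resolvent, dif_pos h']
  exact h'.choose_spec

theorem IsResolventAt.unique {B : X →ₗ.[ℂ] X} {ζ : ℂ} {R S : X →L[ℂ] X}
    (hR : IsResolventAt B ζ R) (hS : IsResolventAt B ζ S) : R = S := by
  ext x
  obtain ⟨h, hx⟩ := hR.1 x
  have := hS.2 ⟨R x, h⟩
  rw [hx] at this
  exact this.symm

/-- `P` is the projection of `X` onto `M` along `N`. -/
def IsProjectionOntoAlong (P : X →L[ℂ] X) (M N : Submodule ℂ X) : Prop :=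
  P.comp P = P ∧ LinearMap.range (P : X →ₗ[ℂ] X) = M ∧ LinearMap.ker (P : X →ₗ[ℂ] X) = N

end Unbounded

namespace C0Semigroup

variable {X : Type*} [NormedAddCommGroup X] [NormedSpace ℂ X]

/-- The graph of the generator: the pairs `(x, y)` with `(T_h x - x) / h → y` as `h → 0⁺`. -/
def generatorGraph (T : C0Semigroup X) : Submodule ℂ (X × X) where
  carrier := {p | Tendsto (fun h : ℝ≥0 => (h : ℝ)⁻¹ • (T.op h p.1 - p.1)) (𝓝[>] 0) (𝓝 p.2)}
  zero_mem' := by simp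
  add_mem' := by
    intro p q hp hq
    refine (Tendsto.add hp hq).congr fun h => ?_
    simp only [Prod.fst_add, map_add, ← smul_add]
    congr 1
    abel
  smul_mem' := by
    intro c p hp
    refine (Tendsto.const_smul hp c).congr fun h => ?_
    simp only [Prod.smul_fst, map_smul, ← smul_sub]
    rw [smul_comm]

/-- The (infinitesimal) generator of the semigroup, an operator with domain in `X`. -/
noncomputable def generator (T : C0Semigroup X) : X →ₗ.[ℂ] X :=
  T.generatorGraph.toLinearPMap

theorem mem_graph_generator (T : C0Semigroup X) (x y : X) :
    (x, y) ∈ T.generator.graph ↔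
      Tendsto (fun h : ℝ≥0 => (h : ℝ)⁻¹ • (T.op h x - x)) (𝓝[>] 0) (𝓝 y) := by
  rw [generator, Submodule.toLinearPMap_graph_eq]
  · rfl
  · rintro ⟨u, v⟩ huv hu
    obtain rfl : u = 0 := hu
    have huv' : Tendsto (fun h : ℝ≥0 => (h : ℝ)⁻¹ • (T.op h (0 : X) - 0)) (𝓝[>] 0) (𝓝 v) := huv
    simp only [map_zero, sub_zero, smul_zero] at huv'
    exact tendsto_nhds_unique huv' tendsto_const_nhds

/-- The truncated Abel integral `r ∫₀ᵗ e^{-rs} T_s x ds`; its limit as `t → ∞` is the improper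
integral `r ∫₀^∞ e^{-rs} T_s x ds`. -/
noncomputable def abelIntegral (T : C0Semigroup X) (r t : ℝ) (x : X) : X :=
  r • ∫ s in (0 : ℝ)..t, Real.exp (-(r * s)) • T.op s.toNNReal x

/-- The Abel average `Ã_r = r R(r, B)`, where `B` is the generator. -/
noncomputable def abelAverage (T : C0Semigroup X) (r : ℝ) : X →L[ℂ] X :=
  (r : ℂ) • resolvent T.generator (r : ℂ)

end C0Semigroup

end AbelPower

/-!
Write `R` for the resolvent of the generator `B` at `r > 0` and `A = r R` for the Abel average.

The first two assertions are the Laplace transform representation of the resolvent. Wherever the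
improper integral converges, to `z` say, the semigroup law gives `T_h z = e^{rh} (z - F(h))` with
`F(h) = ∫₀ʰ e^{-rs} T_s x ds`, and differentiating at `h = 0` gives `(r - B) z = x`
(`mem_graph_generator_of_tendsto_integral`). For large `r` the integral converges because the
semigroup is exponentially bounded (`exists_exp_bound`).

For the remaining assertions, everything about `B` is translated into a statement about the bounded
operator `A`: `Ker B = ker (1 - A)`, `Im B = range (1 - A)` (`IsResolventAt.kernel_eq`,
`IsResolventAt.image_eq`), and `μ - A` is invertible if and only if `r - r / μ ∈ ρ(B)`
(`IsResolventAt.isUnit_iff`). The map `μ ↦ r - r / μ` takes the closed exterior of the unit disc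
without `1` into the open right half-plane, and its open exterior onto the disc `|ζ - r| < r`
without the centre; these discs exhaust the half-plane as `r` varies.

If `A ^ n → P` in norm, then `P` is the projection onto `ker (1 - A)` along `range (1 - A)`
(`isProjectionOntoAlong_of_tendsto_pow`), which gives the description of the limit and the direct
sum decomposition; moreover the spectrum of `A` lies in the closed unit disc, so that convergence for
all `r` puts the whole right half-plane into `ρ(B)`. Conversely, if `X = Ker B ⊕ Im B`, the
projection `P` onto `Ker B` is automatically bounded, and if in addition `ρ(B)` contains the right
half-plane, the spectrum of `A - P` lies in the open unit disc, so `A ^ n - P = (A - P) ^ n → 0` by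
Gelfand's formula (`exists_tendsto_pow_of_isCompl`).
-/

/-! ### Powers of an element of a Banach algebra -/

section BanachAlgebra

/-- If the powers of `a` tend to zero, then some `1 - a ^ n = (1 - a) * (1 + a + ⋯)` is invertible by
the Neumann series, hence so is `1 - a`. -/
theorem isUnit_one_sub_of_tendsto_pow_zero {A : Type*} [NormedRing A] [CompleteSpace A] {a : A}
    (h : Tendsto (fun n : ℕ => a ^ n) atTop (𝓝 0)) : IsUnit (1 - a) := by
  obtain ⟨n, hn⟩ := ((tendsto_zero_iff_norm_tendsto_zero.1 h).eventually
    (gt_mem_nhds zero_lt_one)).exists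
  have hu : IsUnit (1 - a ^ n) := isUnit_one_sub_of_norm_lt_one hn
  rw [← mul_neg_geom_sum] at hu
  have hc : Commute (1 - a) (∑ i ∈ Finset.range n, a ^ i) :=
    Commute.sum_right _ _ _ fun i _ => ((Commute.one_left a).sub_left (Commute.refl a)).pow_right i
  exact (hc.isUnit_mul_iff.1 hu).1

/-- Gelfand's formula, in the form: an element whose spectrum lies in the open unit disc has powers
tending to zero. -/
theorem tendsto_pow_zero_of_spectrum_lt_one {A : Type*} [NormedRing A] [NormedAlgebra ℂ A]
    [CompleteSpace A] {a : A} (h : ∀ z ∈ spectrum ℂ a, ‖z‖ < 1) :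
    Tendsto (fun n : ℕ => a ^ n) atTop (𝓝 0) := by
  rcases subsingleton_or_nontrivial A with hA | hA
  · exact tendsto_const_nhds.congr fun n => Subsingleton.elim _ _
  have hlt : spectralRadius ℂ a < (1 : ℝ≥0) :=
    spectrum.spectralRadius_lt_of_forall_lt a fun z hz => by simpa [← NNReal.coe_lt_coe] using h z hz
  obtain ⟨q, hq₁, hq₂⟩ := ENNReal.lt_iff_exists_nnreal_btwn.1 hlt
  have hq : (q : ℝ) < 1 := by exact_mod_cast hq₂
  refine squeeze_zero_norm' ?_ (tendsto_pow_atTop_nhds_zero_of_lt_one q.coe_nonneg hq)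
  filter_upwards [(spectrum.pow_nnnorm_pow_one_div_tendsto_nhds_spectralRadius a).eventually
    (gt_mem_nhds hq₁), eventually_gt_atTop 0] with n hn hn0
  have hn' : (n : ℝ) ≠ 0 := by exact_mod_cast hn0.ne'
  have := ENNReal.rpow_le_rpow hn.le (Nat.cast_nonneg (α := ℝ) n)
  rw [← ENNReal.rpow_mul, one_div_mul_cancel hn', ENNReal.rpow_one, ENNReal.rpow_natCast] at this
  exact_mod_cast this

/-- If the powers of `a` converge, they are bounded, so the spectrum of `a` lies in the closed unit
disc. -/
theorem isUnit_sub_of_tendsto_pow {A : Type*} [NormedRing A] [NormedAlgebra ℂ A]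
    [CompleteSpace A] {a p : A} (h : Tendsto (fun n : ℕ => a ^ n) atTop (𝓝 p)) {μ : ℂ}
    (hμ : 1 < ‖μ‖) : IsUnit (algebraMap ℂ A μ - a) := by
  have hμ0 : μ ≠ 0 := norm_pos_iff.1 (one_pos.trans hμ)
  have hz : Tendsto (fun n : ℕ => (μ⁻¹) ^ n) atTop (𝓝 0) :=
    tendsto_pow_atTop_nhds_zero_of_norm_lt_one (by rw [norm_inv]; exact inv_lt_one_of_one_lt₀ hμ)
  have h0 : Tendsto (fun n : ℕ => (μ⁻¹ • a) ^ n) atTop (𝓝 0) := by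
    simpa [smul_pow] using hz.smul h
  have hu := (isUnit_one_sub_of_tendsto_pow_zero h0).smul (Units.mk0 μ hμ0)
  rwa [Units.smul_mk0, smul_sub, smul_inv_smul₀ hμ0, ← Algebra.algebraMap_eq_smul_one] at hu

end BanachAlgebra

/-! ### Norm convergence of the powers of a bounded operator -/

section Powers

variable {X : Type*} [NormedAddCommGroup X] [NormedSpace ℂ X] [CompleteSpace X]

/-- A norm limit of the powers of `A` is the projection onto the fixed space of `A` along the range
of `1 - A`. Only the inclusion `ker P ⊆ range (1 - A)` requires convergence in norm: it makes
`1 - (A - P)` invertible. -/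
theorem isProjectionOntoAlong_of_tendsto_pow {A P : X →L[ℂ] X}
    (h : Tendsto (fun n : ℕ => A ^ n) atTop (𝓝 P)) :
    AbelPower.IsProjectionOntoAlong P (LinearMap.ker ((1 - A : X →L[ℂ] X) : X →ₗ[ℂ] X))
      (LinearMap.range ((1 - A : X →L[ℂ] X) : X →ₗ[ℂ] X)) := by
  have hs : Tendsto (fun n : ℕ => A ^ (n + 1)) atTop (𝓝 P) := h.comp (tendsto_add_atTop_nat 1)
  have hAP : A * P = P := tendsto_nhds_unique
    ((h.const_mul A).congr fun n => (pow_succ' A n).symm) hs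
  have hPA : P * A = P := tendsto_nhds_unique
    ((h.mul_const A).congr fun n => (pow_succ A n).symm) hs
  have hAnP (n : ℕ) : A ^ n * P = P := by
    induction n with
    | zero => simp
    | succ n ih => rw [pow_succ, mul_assoc, hAP, ih]
  have hPP : P * P = P := tendsto_nhds_unique (h.mul_const P)
    (tendsto_const_nhds.congr fun n => (hAnP n).symm)
  have hpow (n : ℕ) : (A - P) ^ (n + 1) = A ^ (n + 1) - P := by
    induction n with
    | zero => simp
    | succ n ih =>
      rw [pow_succ, ih, sub_mul, mul_sub, mul_sub, hAnP, hPA, hPP, ← pow_succ]; abel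
  have h0 : Tendsto (fun n : ℕ => (A - P) ^ n) atTop (𝓝 0) := by
    rw [← tendsto_add_atTop_iff_nat 1]
    simpa [hpow] using hs.sub_const P
  have hu := isUnit_one_sub_of_tendsto_pow_zero h0
  refine ⟨hPP, ?_, ?_⟩
  · ext x
    simp only [LinearMap.mem_range, LinearMap.mem_ker, ContinuousLinearMap.coe_coe,
      sub_apply, one_apply_eq_self, sub_eq_zero]
    constructor
    · rintro ⟨y, rfl⟩
      exact (DFunLike.congr_fun hAP y).symm
    · intro hx
      refine ⟨x, ?_⟩
      have hfix (n : ℕ) : (A ^ n) x = x := by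
        induction n with
        | zero => simp
        | succ n ih => rw [pow_succ, mul_apply_eq_comp, ← hx, ih]
      have hev : Tendsto (fun n : ℕ => (A ^ n) x) atTop (𝓝 (P x)) :=
        ((ContinuousLinearMap.apply ℂ X x).continuous.tendsto P).comp h
      exact tendsto_nhds_unique hev (tendsto_const_nhds.congr fun n => (hfix n).symm)
  · ext x
    simp only [LinearMap.mem_range, LinearMap.mem_ker, ContinuousLinearMap.coe_coe,
      sub_apply, one_apply_eq_self]
    constructor
    · intro hx
      obtain ⟨y, hy⟩ := (ContinuousLinearMap.isUnit_iff_bijective.1 hu).2 x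
      have hPy : P y = 0 := by
        have e : P * (1 - (A - P)) = P := by rw [mul_sub, mul_sub, hPA, hPP]; simp
        rw [← DFunLike.congr_fun e y, mul_apply_eq_comp, hy, hx]
      refine ⟨y, ?_⟩
      simpa [hPy] using hy
    · rintro ⟨y, rfl⟩
      have := DFunLike.congr_fun hPA y
      rw [mul_apply_eq_comp] at this
      rw [map_sub, this, sub_self]

/-- If the kernel and the range of a bounded operator `C` are algebraically complementary, then the
projection onto the kernel along the range is bounded, by the open mapping theorem for
`(k, x) ↦ k + C x` on `ker C × X`. -/
theorem exists_projection_of_isCompl {C : X →L[ℂ] X}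
    (h : IsCompl (LinearMap.ker (C : X →ₗ[ℂ] X)) (LinearMap.range (C : X →ₗ[ℂ] X))) :
    ∃ P : X →L[ℂ] X, (∀ x, C (P x) = 0) ∧ (∀ x, C x = 0 → P x = x) ∧ ∀ x, P (C x) = 0 := by
  set K := LinearMap.ker (C : X →ₗ[ℂ] X) with hK
  have : CompleteSpace K := C.isClosed_ker.completeSpace_coe
  let φ : (K × X) →L[ℂ] X := K.subtypeL.coprod C
  have hφ : Function.Surjective φ := by
    intro z
    obtain ⟨k, hk, w, ⟨x, rfl⟩, hz⟩ := Submodule.mem_sup.1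
      (h.sup_eq_top ▸ Submodule.mem_top : z ∈ K ⊔ LinearMap.range (C : X →ₗ[ℂ] X))
    exact ⟨(⟨k, hk⟩, x), by simpa [φ] using hz⟩
  obtain ⟨c, -, hc⟩ := φ.exists_preimage_norm_le hφ
  let p : X →ₗ[ℂ] X := K.subtype ∘ₗ K.projectionOnto _ h
  have hpK (k : K) : p k = k := by
    simp [p, Submodule.projectionOnto_apply_left]
  have hpC (x : X) : p (C x) = 0 := by
    have : K.projectionOnto _ h (C x) = 0 :=
      (Submodule.projectionOnto_apply_eq_zero_iff h).2 ⟨x, rfl⟩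
    simp [p, this]
  refine ⟨p.mkContinuous c fun z => ?_, fun x => ?_, fun x hx => ?_, fun x => hpC x⟩
  · obtain ⟨⟨k, x⟩, hz, hle⟩ := hc z
    have e : p z = k := by
      rw [← hz]
      simp only [φ, ContinuousLinearMap.coprod_apply, map_add, hpC, add_zero]
      exact hpK k
    rw [e]
    exact (norm_fst_le (k, x)).trans hle
  · exact (K.projectionOnto _ h x).2
  · exact hpK ⟨x, hx⟩

/-- The powers of `A` converge in norm if `X` is the direct sum of `ker (1 - A)` and
`range (1 - A)` and the spectrum of `A` is contained in the open unit disc and the point `1`.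
With `P` the projection onto the first summand, the spectrum of `A - P` is then contained in the
open unit disc, and `A ^ n - P = (A - P) ^ n` for `n ≥ 1`. -/
theorem exists_tendsto_pow_of_isCompl {A : X →L[ℂ] X}
    (h : IsCompl (LinearMap.ker ((1 - A : X →L[ℂ] X) : X →ₗ[ℂ] X))
      (LinearMap.range ((1 - A : X →L[ℂ] X) : X →ₗ[ℂ] X)))
    (hs : ∀ μ : ℂ, 1 ≤ ‖μ‖ → μ ≠ 1 → IsUnit (algebraMap ℂ (X →L[ℂ] X) μ - A)) :
    ∃ P : X →L[ℂ] X, Tendsto (fun n : ℕ => A ^ n) atTop (𝓝 P) := by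
  obtain ⟨P, h₁, h₂, h₃⟩ := exists_projection_of_isCompl h
  have hCP : (1 - A) * P = 0 := by ext x; exact h₁ x
  have hPC : P * (1 - A) = 0 := by ext x; exact h₃ x
  have hPP : P * P = P := by ext x; exact h₂ _ (h₁ x)
  have hAP : A * P = P := by rw [sub_mul, one_mul, sub_eq_zero] at hCP; exact hCP.symm
  have hPA : P * A = P := by rw [mul_sub, mul_one, sub_eq_zero] at hPC; exact hPC.symm
  have hpow (n : ℕ) : A ^ (n + 1) = (A - P) ^ (n + 1) + P := by
    induction n with
    | zero => simp
    | succ n ih =>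
      have hz : P * (A - P) = 0 := by rw [mul_sub, hPA, hPP, sub_self]
      have hz' : (A - P) ^ (n + 1) * P = 0 := by
        rw [pow_succ, mul_assoc, sub_mul, hAP, hPP, sub_self, mul_zero]
      rw [pow_succ A, ih, pow_succ (A - P) (n + 1), mul_sub, hz', sub_zero, add_mul, hPA]
  have h0 : Tendsto (fun n : ℕ => (A - P) ^ n) atTop (𝓝 0) := by
    refine tendsto_pow_zero_of_spectrum_lt_one fun μ hμ => ?_
    by_contra! hle
    refine hμ ?_
    have hμ0 : μ ≠ 0 := norm_pos_iff.1 (one_pos.trans_le hle)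
    change IsUnit _
    by_cases hμ1 : μ = 1
    · rw [hμ1, map_one, ContinuousLinearMap.isUnit_iff_bijective]
      have e (x : X) : (1 - (A - P)) x = (1 - A) x + P x := by simp; abel
      constructor
      · rw [injective_iff_map_eq_zero]
        intro x hx
        rw [e] at hx
        have hPx : P x = 0 := by
          have := congrArg P hx
          rwa [map_add, h₃, zero_add, map_zero, h₂ _ (h₁ x)] at this
        rw [hPx, add_zero] at hx
        rw [← h₂ x hx, hPx]
      · intro z
        have hz : z - P z ∈ LinearMap.range ((1 - A : X →L[ℂ] X) : X →ₗ[ℂ] X) := by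
          obtain ⟨k, hk, w, ⟨y, rfl⟩, rfl⟩ := Submodule.mem_sup.1
            (h.sup_eq_top ▸ Submodule.mem_top : z ∈ _ ⊔ _)
          refine ⟨y, ?_⟩
          have hk' : P k = k := h₂ k hk
          have hy' : P ((1 - A) y) = 0 := h₃ y
          simp_all
        obtain ⟨y, hy⟩ := hz
        have hy' : (1 - A) y = z - P z := hy
        refine ⟨y - P y + P z, ?_⟩
        rw [e, map_add, map_sub, h₁, h₁, hy', map_add, map_sub, h₂ _ (h₁ y), h₂ _ (h₁ z)]
        abel
    · -- `μ - (A - P) = (μ - A) * (1 + c P)` with `c = (μ - 1)⁻¹`, and `1 - μ⁻¹ P` inverts the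
      -- second factor
      have hμ1' : μ - 1 ≠ 0 := sub_ne_zero.2 hμ1
      have hu : IsUnit (1 + (μ - 1)⁻¹ • P) := by
        have key (c d : ℂ) (hcd : c + d + c * d = 0) : (1 + c • P) * (1 + d • P) = 1 := by
          have : (1 + c • P) * (1 + d • P) = 1 + (c + d + c * d) • P := by
            simp only [add_mul, mul_add, one_mul, mul_one, smul_mul_smul_comm, hPP, add_smul]
            abel
          rw [this, hcd, zero_smul, add_zero]
        have hcd : (μ - 1)⁻¹ + -μ⁻¹ + (μ - 1)⁻¹ * -μ⁻¹ = 0 := by field_simp; ring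
        exact ⟨⟨_, 1 + (-μ⁻¹) • P, key _ _ hcd, key _ _ (by rw [← hcd]; ring)⟩, rfl⟩
      have e : algebraMap ℂ (X →L[ℂ] X) μ - (A - P) =
          (algebraMap ℂ (X →L[ℂ] X) μ - A) * (1 + (μ - 1)⁻¹ • P) := by
        have : (algebraMap ℂ (X →L[ℂ] X) μ - A) * P = (μ - 1) • P := by
          rw [sub_mul, hAP, Algebra.algebraMap_eq_smul_one, smul_mul_assoc, one_mul, sub_smul,
            one_smul]
        rw [mul_add, mul_one, mul_smul_comm, this, inv_smul_smul₀ hμ1']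
        abel
      rw [e]
      exact (hs μ hle hμ1).mul hu
  refine ⟨P, ?_⟩
  rw [← tendsto_add_atTop_iff_nat 1]
  have := ((tendsto_add_atTop_iff_nat 1).2 h0).add_const P
  rw [zero_add] at this
  exact this.congr fun n => (hpow n).symm

end Powers

namespace AbelPower

/-! ### The operator `r (r - B)⁻¹` -/

section Resolvent

variable {X : Type*} [NormedAddCommGroup X] [NormedSpace ℂ X] {B : X →ₗ.[ℂ] X} {r ζ : ℂ}
  {R S : X →L[ℂ] X}

theorem mem_kernel_iff {x : X} : x ∈ kernel B ↔ ∃ h : x ∈ B.domain, B ⟨x, h⟩ = 0 := by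
  simp only [kernel, Submodule.mem_map, LinearMap.mem_ker]
  constructor
  · rintro ⟨y, hy, rfl⟩
    exact ⟨y.2, hy⟩
  · rintro ⟨h, hx⟩
    exact ⟨⟨x, h⟩, hx, rfl⟩

theorem IsResolventAt.kernel_eq (hR : IsResolventAt B r R) :
    kernel B = LinearMap.ker ((1 - r • R : X →L[ℂ] X) : X →ₗ[ℂ] X) := by
  ext x
  rw [mem_kernel_iff, LinearMap.mem_ker]
  simp only [ContinuousLinearMap.coe_coe, sub_apply,
    one_apply_eq_self, smul_apply, sub_eq_zero]
  constructor
  · rintro ⟨h, hx⟩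
    have := hR.2 ⟨x, h⟩
    rw [hx, sub_zero, map_smul] at this
    exact this.symm
  · intro hx
    obtain ⟨h, hB⟩ := hR.1 x
    have h0 : B ⟨R x, h⟩ = 0 := by
      rwa [← hx, sub_eq_self] at hB
    have e : (⟨x, hx ▸ B.domain.smul_mem r h⟩ : B.domain) = r • ⟨R x, h⟩ := Subtype.ext hx
    exact ⟨_, by rw [e, LinearPMap.map_smul, h0, smul_zero]⟩

theorem IsResolventAt.image_eq (hR : IsResolventAt B r R) :
    image B = LinearMap.range ((1 - r • R : X →L[ℂ] X) : X →ₗ[ℂ] X) := by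
  ext x
  simp only [image, LinearMap.mem_range, ContinuousLinearMap.coe_coe,
    sub_apply, one_apply_eq_self, smul_apply]
  constructor
  · rintro ⟨y, rfl⟩
    refine ⟨B y - r • (y : X), ?_⟩
    have := hR.2 y
    rw [← neg_sub (r • (y : X)), map_neg, this, LinearPMap.toFun_eq_coe]
    module
  · rintro ⟨z, rfl⟩
    obtain ⟨h, hB⟩ := hR.1 z
    refine ⟨-⟨R z, h⟩, ?_⟩
    rw [map_neg, LinearPMap.toFun_eq_coe]
    nth_rewrite 2 [← hB]
    abel

/-- One order of the resolvent identity; the other follows by exchanging the two points. -/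
theorem IsResolventAt.sub_eq (hR : IsResolventAt B r R) (hS : IsResolventAt B ζ S) :
    S - R = (r - ζ) • (R * S) := by
  ext x
  obtain ⟨h, hB⟩ := hS.1 x
  have := hR.2 ⟨S x, h⟩
  have e : r • S x - B ⟨S x, h⟩ = x + (r - ζ) • S x := by
    nth_rewrite 3 [← hB]
    module
  simp only [e, map_add, map_smul] at this
  simp only [sub_apply, smul_apply,
    mul_apply_eq_comp]
  rw [sub_eq_iff_eq_add', this]

/-- The spectral mapping theorem for the resolvent: `μ - r R(r, B) = μ (ζ - B) R(r, B)` with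
`ζ = r - r / μ`. -/
theorem IsResolventAt.isUnit_iff (hR : IsResolventAt B r R) {μ : ℂ} (hμ : μ ≠ 0) :
    IsUnit (algebraMap ℂ (X →L[ℂ] X) μ - r • R) ↔ r - r / μ ∈ resolventSet B := by
  have hM (x : X) : (algebraMap ℂ (X →L[ℂ] X) μ - r • R) x = μ • x - r • R x := by
    simp [Algebra.algebraMap_eq_smul_one]
  constructor
  · rintro ⟨u, hu⟩
    -- the resolvent at `r - r / μ` is `μ R G`, where `G` inverts `μ - r R`
    set G : X →L[ℂ] X := ↑u⁻¹
    have hG₁ (x : X) : μ • G x - r • R (G x) = x := by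
      have := DFunLike.congr_fun u.mul_inv x
      rwa [hu, mul_apply_eq_comp, hM] at this
    have hG₂ (x : X) : G (μ • x - r • R x) = x := by
      have := DFunLike.congr_fun u.inv_mul x
      rwa [hu, mul_apply_eq_comp, hM] at this
    refine ⟨R * (μ • G), fun x => ?_, fun y => ?_⟩
    · obtain ⟨h, hB⟩ := hR.1 (μ • G x)
      refine ⟨h, ?_⟩
      change (r - r / μ) • R (μ • G x) - B ⟨R (μ • G x), h⟩ = x
      rw [sub_smul, sub_right_comm, hB, map_smul, smul_smul, div_mul_cancel₀ _ hμ]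
      exact hG₁ x
    · have hy := hR.2 y
      set w := r • (y : X) - B y with hw
      have e : (r - r / μ) • (y : X) - B y = μ⁻¹ • (μ • w - r • R w) := by
        rw [smul_sub, inv_smul_smul₀ hμ, hy, hw]
        module
      rw [e]
      change R (μ • G (μ⁻¹ • (μ • w - r • R w))) = y
      rw [map_smul G, hG₂, smul_inv_smul₀ hμ, hy]
  · rintro ⟨S, hS⟩
    have h₁ := hR.sub_eq hS
    have h₂ := hS.sub_eq hR
    rw [sub_sub_cancel] at h₁
    rw [sub_sub_cancel_left] at h₂
    refine ⟨⟨_, μ⁻¹ • (1 + (r / μ) • S), ?_, ?_⟩, rfl⟩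
    · have e : (algebraMap ℂ (X →L[ℂ] X) μ - r • R) * (μ⁻¹ • (1 + (r / μ) • S)) =
          (μ⁻¹ * μ) • (1 : X →L[ℂ] X) +
            (r / μ) • (((μ⁻¹ * μ) • S - R) - (r / μ) • (R * S)) := by
        rw [Algebra.algebraMap_eq_smul_one]
        simp only [sub_mul, mul_add, smul_mul_assoc, mul_smul_comm, one_mul, mul_one]
        module
      rw [e, inv_mul_cancel₀ hμ, one_smul, one_smul, h₁]
      simp
    · have e : (μ⁻¹ • (1 + (r / μ) • S)) * (algebraMap ℂ (X →L[ℂ] X) μ - r • R) =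
          (μ⁻¹ * μ) • (1 : X →L[ℂ] X) -
            (r / μ) • ((R - (μ⁻¹ * μ) • S) - (-(r / μ)) • (S * R)) := by
        rw [Algebra.algebraMap_eq_smul_one]
        simp only [add_mul, mul_sub, smul_mul_assoc, mul_smul_comm, one_mul, mul_one]
        module
      rw [e, inv_mul_cancel₀ hμ, one_smul, one_smul, h₂]
      simp

end Resolvent

/-! ### The Abel averages as Laplace transforms -/

namespace C0Semigroup

section Semigroup

variable {X : Type*} [NormedAddCommGroup X] [NormedSpace ℂ X] (T : C0Semigroup X)

/-- By uniform boundedness the semigroup is bounded on `[0, 1]`, hence exponentially bounded. -/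
theorem exists_exp_bound [CompleteSpace X] :
    ∃ M ω : ℝ, ∀ t : ℝ≥0, ‖T.op t‖ ≤ M * Real.exp (ω * t) := by
  obtain ⟨C, hC⟩ : ∃ C : ℝ, ∀ t : Set.Icc (0 : ℝ≥0) 1, ‖T.op t‖ ≤ C := by
    refine banach_steinhaus fun x => ?_
    obtain ⟨C, hC⟩ := (isCompact_Icc (a := (0 : ℝ≥0)) (b := 1)).exists_bound_of_continuousOn
      (T.continuous_orbit x).continuousOn
    exact ⟨C, fun t => hC t t.2⟩
  set M := max C 1
  have hM1 : 1 ≤ M := le_max_right _ _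
  have hM0 : 0 < M := one_pos.trans_le hM1
  have hM (t : ℝ≥0) (ht : t ≤ 1) : ‖T.op t‖ ≤ M :=
    (hC ⟨t, zero_le, ht⟩).trans (le_max_left _ _)
  have hn (n : ℕ) : ∀ t : ℝ≥0, t ≤ n + 1 → ‖T.op t‖ ≤ M ^ (n + 1) := by
    induction n with
    | zero => intro t ht; simpa using hM t (by simpa using ht)
    | succ n ih =>
      intro t ht
      rcases le_total t 1 with h | h
      · exact (hM t h).trans (le_self_pow₀ hM1 (by simp))
      · have ht' : t - 1 ≤ n + 1 := by
          rw [tsub_le_iff_right]; simpa using ht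
        rw [← add_tsub_cancel_of_le h, T.op_add, pow_succ']
        exact (ContinuousLinearMap.opNorm_comp_le _ _).trans
          (mul_le_mul (hM 1 le_rfl) (ih _ ht') (norm_nonneg _) hM0.le)
  refine ⟨M, Real.log M, fun t => (hn ⌊t⌋₊ t (Nat.lt_floor_add_one t).le).trans ?_⟩
  rw [pow_succ', ← Real.rpow_def_of_pos hM0, ← Real.rpow_natCast]
  gcongr M * M ^ ?_
  · exact_mod_cast Nat.floor_le (zero_le : 0 ≤ t)

theorem continuous_exp_smul_op (r : ℝ) (x : X) :
    Continuous fun s : ℝ => Real.exp (-(r * s)) • T.op s.toNNReal x :=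
  (by fun_prop : Continuous fun s : ℝ => Real.exp (-(r * s))).smul
    ((T.continuous_orbit x).comp continuous_real_toNNReal)

/-- If the improper integral `∫₀^∞ e^{-rs} T_s x ds` converges to `z`, then `z ∈ D(B)` and
`(r - B) z = x`. Convergence is only needed to let `t → ∞` in
`e^{-rh} T_h F(t) = F(t + h) - F(h)`, where `F` is the indefinite integral; the result
`T_h z = e^{rh} (z - F(h))` is differentiable at `h = 0`. -/
theorem mem_graph_generator_of_tendsto_integral [CompleteSpace X] {r : ℝ} {x z : X}
    (hz : Tendsto (fun t : ℝ => ∫ s in (0 : ℝ)..t, Real.exp (-(r * s)) • T.op s.toNNReal x)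
      atTop (𝓝 z)) :
    (z, r • z - x) ∈ T.generator.graph := by
  rw [mem_graph_generator]
  set f : ℝ → X := fun s => Real.exp (-(r * s)) • T.op s.toNNReal x with hf
  have hfc : Continuous f := T.continuous_exp_smul_op r x
  set F : ℝ → X := fun t => ∫ s in (0 : ℝ)..t, f s with hF
  have hshift (h : ℝ≥0) (t : ℝ) (ht : 0 ≤ t) :
      Real.exp (-(r * h)) • T.op h (F t) = F (t + h) - F h := by
    have e₁ : T.op h (F t) = ∫ s in (0 : ℝ)..t, T.op h (f s) :=
      ((T.op h).intervalIntegral_comp_comm (hfc.intervalIntegrable 0 t)).symm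
    have e₂ : F (t + h) - F h = ∫ s in (0 : ℝ)..t, f (s + h) := by
      rw [intervalIntegral.integral_comp_add_right, zero_add]
      exact intervalIntegral.integral_interval_sub_left (hfc.intervalIntegrable _ _)
        (hfc.intervalIntegrable _ _)
    rw [e₁, e₂, ← intervalIntegral.integral_smul]
    refine intervalIntegral.integral_congr fun s hs => ?_
    rw [Set.uIcc_of_le ht] at hs
    simp only [hf]
    rw [Real.toNNReal_add hs.1 h.coe_nonneg, Real.toNNReal_coe, add_comm s.toNNReal, T.op_add,
      ContinuousLinearMap.comp_apply, ContinuousLinearMap.map_smul_of_tower, smul_smul,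
      ← Real.exp_add]
    congr 2
    ring
  have hTz (h : ℝ≥0) : T.op h z = Real.exp (r * h) • (z - F h) := by
    have h₁ : Tendsto (fun t : ℝ => Real.exp (-(r * h)) • T.op h (F t)) atTop
        (𝓝 (Real.exp (-(r * h)) • T.op h z)) :=
      (((T.op h).continuous.tendsto z).comp hz).const_smul _
    have h₂ : Tendsto (fun t : ℝ => F (t + h) - F h) atTop (𝓝 (z - F h)) :=
      (hz.comp (tendsto_atTop_add_const_right _ _ tendsto_id)).sub_const _
    have h₃ := tendsto_nhds_unique (h₁.congr' (by
      filter_upwards [eventually_ge_atTop 0] with t ht using hshift h t ht)) h₂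
    rw [← h₃, smul_smul, ← Real.exp_add, add_neg_cancel, Real.exp_zero, one_smul]
  have hF0 : F 0 = 0 := intervalIntegral.integral_same
  have hf0 : f 0 = x := by simp [hf, T.op_zero]
  have hFd : HasDerivAt F x 0 := by
    have := intervalIntegral.integral_hasDerivAt_right (hfc.intervalIntegrable 0 0)
      hfc.stronglyMeasurable.stronglyMeasurableAtFilter hfc.continuousAt
    rwa [hf0] at this
  have hgd : HasDerivAt (fun h : ℝ => Real.exp (r * h) • (z - F h)) (r • z - x) 0 := by
    have he : HasDerivAt (fun h : ℝ => Real.exp (r * h)) r 0 := by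
      simpa using ((hasDerivAt_id (0 : ℝ)).const_mul r).exp
    have := he.smul (hFd.const_sub z)
    simp only [mul_zero, Real.exp_zero, one_smul, hF0, sub_zero] at this
    rwa [neg_add_eq_sub] at this
  have hcoe : Tendsto (fun h : ℝ≥0 => (h : ℝ)) (𝓝[>] 0) (𝓝[≠] 0) := by
    refine tendsto_nhdsWithin_iff.2 ⟨?_, ?_⟩
    · exact (NNReal.continuous_coe.tendsto' 0 0 rfl).mono_left nhdsWithin_le_nhds
    · filter_upwards [self_mem_nhdsWithin] with h hh
      exact (NNReal.coe_pos.2 hh).ne'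
  refine ((hasDerivAt_iff_tendsto_slope.1 hgd).comp hcoe).congr fun h => ?_
  simp [slope_def_module, hTz, hF0]

/-- Where the improper integral converges, it computes the Abel average. -/
theorem abelAverage_eq_of_tendsto [CompleteSpace X] {r : ℝ} (hr : r ≠ 0)
    (hρ : (r : ℂ) ∈ resolventSet T.generator) {x y : X}
    (hy : Tendsto (fun t : ℝ => T.abelIntegral r t x) atTop (𝓝 y)) : T.abelAverage r x = y := by
  have hz := hy.const_smul r⁻¹
  simp only [abelIntegral, inv_smul_smul₀ hr] at hz
  have hg := T.mem_graph_generator_of_tendsto_integral hz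
  rw [smul_inv_smul₀ hr] at hg
  obtain ⟨⟨z, hzd⟩, rfl, hB⟩ := (LinearPMap.mem_graph_iff _).1 hg
  have hR := (isResolventAt_resolvent hρ).2 ⟨_, hzd⟩
  simp only at hB
  rw [hB, Complex.coe_smul, smul_inv_smul₀ hr, sub_sub_cancel] at hR
  rw [abelAverage, smul_apply, hR, Complex.coe_smul, smul_inv_smul₀ hr]

theorem eventually_exists_tendsto_abelIntegral [CompleteSpace X] :
    ∀ᶠ r : ℝ in atTop, ∀ x : X, ∃ y : X,
      Tendsto (fun t : ℝ => T.abelIntegral r t x) atTop (𝓝 y) := by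
  obtain ⟨M, ω, hM⟩ := T.exists_exp_bound
  filter_upwards [eventually_gt_atTop ω] with r hr x
  have hint : MeasureTheory.IntegrableOn
      (fun s : ℝ => Real.exp (-(r * s)) • T.op s.toNNReal x) (Set.Ioi 0) := by
    refine MeasureTheory.Integrable.mono'
      (((exp_neg_integrableOn_Ioi 0 (sub_pos.2 hr)).const_mul (M * ‖x‖)))
      (T.continuous_exp_smul_op r x).aestronglyMeasurable ?_
    refine (MeasureTheory.ae_restrict_iff' measurableSet_Ioi).2 (.of_forall fun s hs => ?_)
    have h₁ : ‖T.op s.toNNReal x‖ ≤ M * Real.exp (ω * s) * ‖x‖ := by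
      have := (T.op s.toNNReal).le_of_opNorm_le (hM s.toNNReal) x
      rwa [Real.coe_toNNReal s (le_of_lt hs)] at this
    rw [norm_smul, Real.norm_eq_abs, Real.abs_exp]
    calc Real.exp (-(r * s)) * ‖T.op s.toNNReal x‖
        ≤ Real.exp (-(r * s)) * (M * Real.exp (ω * s) * ‖x‖) := by gcongr
      _ = M * ‖x‖ * (Real.exp (-(r * s)) * Real.exp (ω * s)) := by ring
      _ = M * ‖x‖ * Real.exp (-(r - ω) * s) := by rw [← Real.exp_add]; ring_nf
  exact ⟨_, (MeasureTheory.intervalIntegral_tendsto_integral_Ioi 0 hint tendsto_id).const_smul r⟩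

end Semigroup

end C0Semigroup

/-! ### Half-planes and discs -/

/-- The image of the complement of the open unit disc, without `1`, under `μ ↦ r - r / μ` lies in the
open right half-plane. -/
theorem re_sub_div_pos {r : ℝ} (hr : 0 < r) {μ : ℂ} (hμ : 1 ≤ ‖μ‖) (hμ1 : μ ≠ 1) :
    0 < ((r : ℂ) - r / μ).re := by
  have hμ0 : μ ≠ 0 := norm_pos_iff.1 (one_pos.trans_le hμ)
  have hinv : ‖μ⁻¹‖ ≤ 1 := by rw [norm_inv]; exact inv_le_one_of_one_le₀ hμ
  have hlt : (μ⁻¹).re < 1 := by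
    refine lt_of_le_of_ne ((Complex.re_le_norm _).trans hinv) fun h => hμ1 ?_
    have hsq : (μ⁻¹).re ^ 2 + (μ⁻¹).im ^ 2 ≤ 1 := by
      have := Complex.sq_norm (μ⁻¹)
      rw [Complex.normSq_apply] at this
      nlinarith [norm_nonneg μ⁻¹]
    have him : (μ⁻¹).im = 0 := by
      rw [h] at hsq; nlinarith [sq_nonneg (μ⁻¹).im]
    have : μ⁻¹ = 1 := Complex.ext h him
    exact inv_eq_one.1 this
  rw [div_eq_mul_inv, Complex.sub_re, Complex.re_ofReal_mul, Complex.ofReal_re]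
  nlinarith

/-- The discs `|ζ - r| < r`, `r > 0`, exhaust the open right half-plane. -/
theorem exists_norm_sub_lt {ζ : ℂ} (hζ : 0 < ζ.re) : ∃ r : ℝ, 0 < r ∧ ‖(r : ℂ) - ζ‖ < r := by
  set r : ℝ := (ζ.re ^ 2 + ζ.im ^ 2) / ζ.re with hr
  have hpos : 0 < ζ.re ^ 2 + ζ.im ^ 2 := by positivity
  have hr0 : 0 < r := by positivity
  refine ⟨r, hr0, lt_of_pow_lt_pow_left₀ 2 hr0.le ?_⟩
  have e : r * ζ.re = ζ.re ^ 2 + ζ.im ^ 2 := div_mul_cancel₀ _ hζ.ne'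
  rw [Complex.sq_norm, Complex.normSq_apply]
  simp only [Complex.sub_re, Complex.sub_im, Complex.ofReal_re, Complex.ofReal_im]
  nlinarith

end AbelPower

theorem theorem2p3 {X : Type*} [NormedAddCommGroup X] [NormedSpace ℂ X] [CompleteSpace X]
    (T : AbelPower.C0Semigroup X)
    (hρ : ∀ r : ℝ, 0 < r → (r : ℂ) ∈ AbelPower.resolventSet T.generator) :
    -- the Abel average is given by the improper integral wherever the latter converges,
    -- and the latter converges everywhere when the parameter is large
    (∀ r : ℝ, 0 < r → ∀ x y : X,
      Tendsto (fun t : ℝ => T.abelIntegral r t x) atTop (𝓝 y) → T.abelAverage r x = y) ∧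
    (∀ᶠ r : ℝ in atTop, ∀ x : X,
      Tendsto (fun t : ℝ => T.abelIntegral r t x) atTop (𝓝 (T.abelAverage r x))) ∧
    -- the three equivalent statements
    List.TFAE [
      {ζ : ℂ | 0 < ζ.re} ⊆ AbelPower.resolventSet T.generator ∧
        IsCompl (AbelPower.kernel T.generator) (AbelPower.image T.generator),
      (∃ r : ℝ, 0 < r ∧ ∃ P : X →L[ℂ] X,
          Tendsto (fun n : ℕ => T.abelAverage r ^ n) atTop (𝓝 P)) ∧
        {ζ : ℂ | 0 < ζ.re} ⊆ AbelPower.resolventSet T.generator,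
      ∀ r : ℝ, 0 < r → ∃ P : X →L[ℂ] X,
        Tendsto (fun n : ℕ => T.abelAverage r ^ n) atTop (𝓝 P)] ∧
    -- the limit
    (∀ r : ℝ, 0 < r → ∀ P : X →L[ℂ] X,
      Tendsto (fun n : ℕ => T.abelAverage r ^ n) atTop (𝓝 P) →
        AbelPower.IsProjectionOntoAlong P
          (AbelPower.kernel T.generator) (AbelPower.image T.generator)) := by
  have hres (r : ℝ) (hr : 0 < r) := AbelPower.isResolventAt_resolvent (hρ r hr)
  have hproj : ∀ r : ℝ, 0 < r → ∀ P : X →L[ℂ] X,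
      Tendsto (fun n : ℕ => T.abelAverage r ^ n) atTop (𝓝 P) →
        AbelPower.IsProjectionOntoAlong P
          (AbelPower.kernel T.generator) (AbelPower.image T.generator) := by
    intro r hr P hP
    rw [(hres r hr).kernel_eq, (hres r hr).image_eq]
    exact isProjectionOntoAlong_of_tendsto_pow hP
  refine ⟨fun r hr x y hy => T.abelAverage_eq_of_tendsto hr.ne' (hρ r hr) hy, ?_, ?_, hproj⟩
  · filter_upwards [T.eventually_exists_tendsto_abelIntegral, eventually_gt_atTop 0] with r hr hr0 x
    obtain ⟨y, hy⟩ := hr x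
    rwa [T.abelAverage_eq_of_tendsto hr0.ne' (hρ r hr0) hy]
  · tfae_have 1 → 3 := by
      rintro ⟨hhalf, hcompl⟩ r hr
      rw [(hres r hr).kernel_eq, (hres r hr).image_eq] at hcompl
      refine exists_tendsto_pow_of_isCompl hcompl fun μ hμ hμ1 => ?_
      exact ((hres r hr).isUnit_iff (norm_pos_iff.1 (one_pos.trans_le hμ))).2
        (hhalf (AbelPower.re_sub_div_pos hr hμ hμ1))
    tfae_have 3 → 2 := by
      refine fun h => ⟨⟨1, one_pos, h 1 one_pos⟩, fun ζ hζ => ?_⟩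
      -- for `r` with `‖r - ζ‖ < r`, the point `μ = r / (r - ζ)` lies outside the closed unit disc
      obtain ⟨r, hr, hlt⟩ := AbelPower.exists_norm_sub_lt hζ
      have hr0 : (r : ℂ) ≠ 0 := by exact_mod_cast hr.ne'
      rcases eq_or_ne (r : ℂ) ζ with rfl | hne
      · exact hρ r hr
      have hne' : (r : ℂ) - ζ ≠ 0 := sub_ne_zero.2 hne
      obtain ⟨P, hP⟩ := h r hr
      have hμ : 1 < ‖(r : ℂ) / (r - ζ)‖ := by
        rwa [norm_div, Complex.norm_of_nonneg hr.le, one_lt_div (norm_pos_iff.2 hne')]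
      have := ((hres r hr).isUnit_iff (div_ne_zero hr0 hne')).1 (isUnit_sub_of_tendsto_pow hP hμ)
      rwa [div_div_cancel₀ hr0, sub_sub_cancel] at this
    tfae_have 2 → 1 := by
      rintro ⟨⟨r, hr, P, hP⟩, hhalf⟩
      obtain ⟨hPP, hrange, hker⟩ := hproj r hr P hP
      refine ⟨hhalf, ?_⟩
      rw [← hrange, ← hker]
      exact (LinearMap.IsIdempotentElem.isCompl
        (ContinuousLinearMap.IsIdempotentElem.toLinearMap hPP))
    tfae_finish
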